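/- For a field $F$ and a partition $\lambda$ of $N$, let $\mathcal O_\lambda\subset M_N(F)$ be the set of nilpotent matrices whose Jordan canonical form has block sizes $\lambda$; for a nilpotent $B\in M_N(F)$ let $\mathcal N(B)$ be the set of nilpotent $A\in M_N(F)$ with $AB=BA$. Write $a^c$ for $c$ copies of the part $a$, and $[M]^k=((q+1)^r,q^{k-r})$ with $q=\lfloor M/k\rfloor$, $r=M \bmod k$. A partition of $2n$ is said to be of type (P1), ..., (P9) if it is of the following form for some integers $z,m,l,t,s$ satisfying the listed constraints, where $0\le z\le n-1$ throughout, $\alpha=\lceil\frac{n+z}{l+2z}\rceil$ and $\beta=\alpha(l+2z)-(n+z)$: * (P1) $[2n]^s$, with $1\le s\le 2n$. * (P2) $([n+m]^{m+z},[n-m]^{l-m+z})$, with either $0<2m\le l<n-z$ and $\lceil\frac{n+m}{m+z}\rceil\ge\lceil\frac{n-m}{l-m+z}\rceil+1$, or $0<m<n-z$ and $l=n-z$. * (P3) $([n+\alpha']^{m+z},[n-\alpha']^{l-m+z})$, with $0<m\le l<n-z$, $l<2m$, $n+l-m>\alpha(l+2z)$, $\alpha'=l-m+(2m-l)\alpha$.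 * (P4) $([n+\alpha'']^{l-m+z},[n-\alpha'']^{m+z})$, with $0<m\le l<n-z$, $l<2m$, $n+m+2z\le\alpha(l+2z)<n+l+z$, $\alpha''=m-(2m-l)\alpha$. * (P5) $([n]^{z+1},[n]^{m+z})$, with $2\le m\le n-z$. * (P6) $((2\alpha)^{l-\beta},(2\alpha-1)^{2z},(2\alpha-2)^{\beta})$, with either $0<m\le l<n-z$, $l<2m$, $\max\{l-m-z,0\}\le\beta<\min\{m+z,l\}$, or $0\le\beta<l<m\le n-z$. * (P7) $((2\alpha-1)^{2l-m+z-\beta},(2\alpha-2)^{2m-l+2z},(2\alpha-3)^{\beta-m-z})$, with $0<m\le l<n-z$, $l<2m$, $\max\{m+z,l\}\le\beta<\min\{2l-m+z,l+2z\}$. * (P8) $([n+\gamma']^{m+z-t},[n-\gamma']^{m+z+t})$, with $0<m<\frac{n-z}2$, $\lceil\frac{n+m+2z}{m+z}\rceil=\lceil\frac{n+m}{m+z}\rceil\ge5$, $1\le t\le\min\{m,\;m-n+\lceil\frac{n-m}{m+z}\rceil(m+z)\}$, $\gamma'=m-\lceil\frac{n-z}{m+z}\rceil t$. * (P9) $([n+\gamma'']^{m+z+t},[n-\gamma'']^{m+z-t})$,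 with $0<m<\frac{n-z}2$, $\lceil\frac{n-m}{m+z}\rceil\le\lceil\frac{n-z}{m+z}\rceil$, $\lceil\frac{n+m}{m+z}\rceil\ge4$, $t\ge1$, $n+z+t\le\lceil\frac{n+m}{m+z}\rceil(m+z)\le n+2m+z-t$, $\gamma''=m+\lceil\frac{n-m-2z}{m+z}\rceil t$. Let $n=11$ and $\lambda=(7,5^3)=(7,5,5,5)$. Then: 1. $\lambda$ is of type (P8), with parameters $z=0$, $m=2$, $t=1$, and is of none of the types (P1)–(P7), (P9). 2. For every field $F$ and every $B\in\mathcal O_{(11,11)}\subset M_{22}(F)$: if $\mathcal O_{(7,5^3)}\cap\mathcal N(B)\neq\emptyset$, then there are non-zero $p_0,q_0\in F$ with $p_0^2+3p_0q_0^2+q_0^4=0$. 3. The equation $p_0^2+3p_0q_0^2+q_0^4=0$ has no solution $(p_0,q_0)\ne(0,0)$ in $\mathbb Q^2$. 4. For $F=\mathbb Q$ and every $B\in\mathcal O_{(11,11)}$ one has $\mathcal O_{(7,5^3)}\cap\mathcal N(B)=\emptyset$. -/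

import Mathlib

/-- The nilpotent `k × k` Jordan block: ones on the superdiagonal, zeros elsewhere. -/
def jordanBlock (F : Type*) [Field F] (k : ℕ) : Matrix (Fin k) (Fin k) F :=
  Matrix.of fun i j => if (i : ℕ) + 1 = (j : ℕ) then 1 else 0

/-- The direct sum of the nilpotent Jordan blocks of sizes `L₀, L₁, …`, in this order. -/
def jordanMatrix (F : Type*) [Field F] (L : List ℕ) :
    Matrix (Σ i : Fin L.length, Fin (L.get i)) (Σ i : Fin L.length, Fin (L.get i)) F :=
  Matrix.blockDiagonal' fun i => jordanBlock F (L.get i)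

/-- The nilpotent orbit `𝒪_p`: the `N × N` matrices over `F` that are `GL_N(F)`-conjugate to the
nilpotent Jordan matrix whose block sizes are the parts of `p` in non-increasing order. The
bijection `e` only numbers the basis; another choice of `e` gives a conjugate matrix. -/
def nilpotentOrbit (F : Type*) [Field F] {N : ℕ} (p : Nat.Partition N) :
    Set (Matrix (Fin N) (Fin N) F) :=
  {A | ∃ (e : (Σ i : Fin (p.parts.sort (· ≥ ·)).length, Fin ((p.parts.sort (· ≥ ·)).get i)) ≃ Fin N)
      (g : GL (Fin N) F),
      A = (g : Matrix (Fin N) (Fin N) F) *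
        Matrix.reindex e e (jordanMatrix F (p.parts.sort (· ≥ ·))) *
        ((g⁻¹ : GL (Fin N) F) : Matrix (Fin N) (Fin N) F)}

/-- The nilpotent centralizer `𝒩(B)`: the nilpotent matrices that commute with `B`. -/
def nilpotentCentralizer {F : Type*} [Field F] {N : ℕ} (B : Matrix (Fin N) (Fin N) F) :
    Set (Matrix (Fin N) (Fin N) F) :=
  {A | A * B = B * A ∧ IsNilpotent A}

/-- The rounded-up quotient `⌈a / b⌉` of two integers, as the ceiling of a rational number. -/
def ceilQuot (a b : ℤ) : ℤ := ⌈(a : ℚ) / (b : ℚ)⌉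

/-- The almost rectangular partition `[M]^k = ((q+1)^r, q^(k-r))` of `M` into `k` parts, where
`q = ⌊M / k⌋` and `r = M mod k`; it has no parts if `k ≤ 0`. -/
def almostRect (M k : ℤ) : Multiset ℤ :=
  if k ≤ 0 then 0
  else Multiset.replicate (M % k).toNat (M / k + 1) + Multiset.replicate (k - M % k).toNat (M / k)

/-- `c` copies of the part `a`. -/
def copies (a c : ℤ) : Multiset ℤ := Multiset.replicate c.toNat a

/-- The parts of a partition as a multiset of integers. -/
def intParts {N : ℕ} (p : Nat.Partition N) : Multiset ℤ := p.parts.map fun k : ℕ => (k : ℤ)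

/-- `α = ⌈(n+z)/(l+2z)⌉`. -/
def tabAlpha (n z l : ℤ) : ℤ := ceilQuot (n + z) (l + 2 * z)

/-- `β = α (l+2z) - (n+z)`. -/
def tabBeta (n z l : ℤ) : ℤ := tabAlpha n z l * (l + 2 * z) - (n + z)

/-- The partition `p` of `2n` is of type (P1). -/
def IsTypeP1 (n : ℕ) (p : Nat.Partition (2 * n)) : Prop :=
  ∃ s : ℤ, 1 ≤ s ∧ s ≤ 2 * n ∧ intParts p = almostRect (2 * n) s

/-- The partition `p` of `2n` is of type (P2). -/
def IsTypeP2 (n : ℕ) (p : Nat.Partition (2 * n)) : Prop :=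
  ∃ z m l : ℤ, 0 ≤ z ∧ z ≤ n - 1 ∧
    ((0 < 2 * m ∧ 2 * m ≤ l ∧ l < n - z ∧
        ceilQuot (n + m) (m + z) ≥ ceilQuot (n - m) (l - m + z) + 1) ∨
      (0 < m ∧ m < n - z ∧ l = n - z)) ∧
    intParts p = almostRect (n + m) (m + z) + almostRect (n - m) (l - m + z)

/-- The partition `p` of `2n` is of type (P3). -/
def IsTypeP3 (n : ℕ) (p : Nat.Partition (2 * n)) : Prop :=
  ∃ z m l α' : ℤ, 0 ≤ z ∧ z ≤ n - 1 ∧ 0 < m ∧ m ≤ l ∧ l < n - z ∧ l < 2 * m ∧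
    n + l - m > tabAlpha n z l * (l + 2 * z) ∧
    α' = l - m + (2 * m - l) * tabAlpha n z l ∧
    intParts p = almostRect (n + α') (m + z) + almostRect (n - α') (l - m + z)

/-- The partition `p` of `2n` is of type (P4). -/
def IsTypeP4 (n : ℕ) (p : Nat.Partition (2 * n)) : Prop :=
  ∃ z m l α'' : ℤ, 0 ≤ z ∧ z ≤ n - 1 ∧ 0 < m ∧ m ≤ l ∧ l < n - z ∧ l < 2 * m ∧
    n + m + 2 * z ≤ tabAlpha n z l * (l + 2 * z) ∧
    tabAlpha n z l * (l + 2 * z) < n + l + z ∧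
    α'' = m - (2 * m - l) * tabAlpha n z l ∧
    intParts p = almostRect (n + α'') (l - m + z) + almostRect (n - α'') (m + z)

/-- The partition `p` of `2n` is of type (P5). -/
def IsTypeP5 (n : ℕ) (p : Nat.Partition (2 * n)) : Prop :=
  ∃ z m : ℤ, 0 ≤ z ∧ z ≤ n - 1 ∧ 2 ≤ m ∧ m ≤ n - z ∧
    intParts p = almostRect n (z + 1) + almostRect n (m + z)

/-- The partition `p` of `2n` is of type (P6). -/
def IsTypeP6 (n : ℕ) (p : Nat.Partition (2 * n)) : Prop :=
  ∃ z m l α β : ℤ, α = tabAlpha n z l ∧ β = tabBeta n z l ∧ 0 ≤ z ∧ z ≤ n - 1 ∧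
    ((0 < m ∧ m ≤ l ∧ l < n - z ∧ l < 2 * m ∧ max (l - m - z) 0 ≤ β ∧ β < min (m + z) l) ∨
      (0 ≤ β ∧ β < l ∧ l < m ∧ m ≤ n - z)) ∧
    intParts p =
      copies (2 * α) (l - β) + copies (2 * α - 1) (2 * z) + copies (2 * α - 2) β

/-- The partition `p` of `2n` is of type (P7). -/
def IsTypeP7 (n : ℕ) (p : Nat.Partition (2 * n)) : Prop :=
  ∃ z m l α β : ℤ, α = tabAlpha n z l ∧ β = tabBeta n z l ∧ 0 ≤ z ∧ z ≤ n - 1 ∧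
    0 < m ∧ m ≤ l ∧ l < n - z ∧ l < 2 * m ∧
    max (m + z) l ≤ β ∧ β < min (2 * l - m + z) (l + 2 * z) ∧
    intParts p =
      copies (2 * α - 1) (2 * l - m + z - β) + copies (2 * α - 2) (2 * m - l + 2 * z) +
        copies (2 * α - 3) (β - m - z)

/-- The partition `p` of `2n` is of type (P8) with the parameters `z`, `m`, `t`. -/
def IsTypeP8With (n : ℕ) (p : Nat.Partition (2 * n)) (z m t : ℤ) : Prop :=
  ∃ γ' : ℤ, 0 ≤ z ∧ z ≤ n - 1 ∧ 0 < m ∧ 2 * m < n - z ∧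
    ceilQuot (n + m + 2 * z) (m + z) = ceilQuot (n + m) (m + z) ∧
    ceilQuot (n + m) (m + z) ≥ 5 ∧
    1 ≤ t ∧ t ≤ min m (m - n + ceilQuot (n - m) (m + z) * (m + z)) ∧
    γ' = m - ceilQuot (n - z) (m + z) * t ∧
    intParts p = almostRect (n + γ') (m + z - t) + almostRect (n - γ') (m + z + t)

/-- The partition `p` of `2n` is of type (P8). -/
def IsTypeP8 (n : ℕ) (p : Nat.Partition (2 * n)) : Prop :=
  ∃ z m t : ℤ, IsTypeP8With n p z m t

/-- The partition `p` of `2n` is of type (P9). -/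
def IsTypeP9 (n : ℕ) (p : Nat.Partition (2 * n)) : Prop :=
  ∃ z m t γ'' : ℤ, 0 ≤ z ∧ z ≤ n - 1 ∧ 0 < m ∧ 2 * m < n - z ∧
    ceilQuot (n - m) (m + z) ≤ ceilQuot (n - z) (m + z) ∧
    ceilQuot (n + m) (m + z) ≥ 4 ∧ 1 ≤ t ∧
    n + z + t ≤ ceilQuot (n + m) (m + z) * (m + z) ∧
    ceilQuot (n + m) (m + z) * (m + z) ≤ n + 2 * m + z - t ∧
    γ'' = m + ceilQuot (n - m - 2 * z) (m + z) * t ∧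
    intParts p = almostRect (n + γ'') (m + z + t) + almostRect (n - γ'') (m + z - t)

/-- The partition `(11, 11)` of `22`. -/
def part11_11 : Nat.Partition (2 * 11) where
  parts := {11, 11}
  parts_pos := by simp
  parts_sum := rfl

/-- The partition `(7, 5³)` of `22`. -/
def part7_555 : Nat.Partition (2 * 11) where
  parts := {7, 5, 5, 5}
  parts_pos := by simp
  parts_sum := rfl

/-! The type conditions bound their parameters once `n = 11`, so Part 1 is a finite check. For the
rest, `B` with two blocks of size 11 makes `F^22` a free module of rank 2 over `F[X]/(X^11)`, `X`
acting as `B`, so a commuting `A` lifts to a 2×2 matrix `M` over `F[X]`. Only the block of size 7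
contributes to `A^5`, which has rank at most 2; the nilpotent `B` preserves its range, hence `B^2
A^5 = 0` and `X^9` divides `M^5`. Since `A^6 ≠ 0`, `X^11` does not divide `M^6`. Reducing powers by
Cayley-Hamilton turns both facts into statements on the trace `τ` and determinant `δ`
(`Matrix.dvd_of_primitive_of_dvd_pow_five`). A valuation argument (`exists_quartic_solution_or_dvd`)
then forces `τ = X^2 t`, `δ = X^4 d` with `t^4 - 3t^2 d + d^2` vanishing at 0, and `A^6 ≠ 0`
excludes `t(0) = d(0) = 0`. So `p₀ = -d(0)`, `q₀ = t(0)` solve the quartic. Over `ℚ` a solution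
would make 5 a square. -/

/-! ### Types of the partition: finite checks. -/

theorem part7_555_isTypeP8With : IsTypeP8With 11 part7_555 0 2 1 :=
  -- `γ' = 2 - ⌈11/2⌉ · 1 = -4`, giving `[7]^1` and `[15]^3`.
  ⟨-4, by decide +kernel⟩

theorem part7_555_not_isTypeP1 : ¬ IsTypeP1 11 part7_555 := by
  rintro ⟨s, h1, h2, h⟩
  have key : ∀ s ∈ Finset.Icc (1 : ℤ) 22, intParts part7_555 ≠ almostRect (2 * (11 : ℕ)) s := by
    decide +kernel
  exact key s (by simp; grind) h

theorem part7_555_not_isTypeP2 : ¬ IsTypeP2 11 part7_555 := by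
  rintro ⟨z, m, l, h0, h1, h2, h⟩
  have key : ∀ z ∈ Finset.Icc (0 : ℤ) 10, ∀ l ∈ Finset.Icc (0 : ℤ) (11 - z),
      ∀ m ∈ Finset.Icc (0 : ℤ) (11 - z),
      ((0 < 2 * m ∧ 2 * m ≤ l ∧ l < (11 : ℕ) - z ∧
        ceilQuot ((11 : ℕ) + m) (m + z) ≥ ceilQuot ((11 : ℕ) - m) (l - m + z) + 1) ∨
      (0 < m ∧ m < (11 : ℕ) - z ∧ l = (11 : ℕ) - z)) →
      intParts part7_555 ≠
        almostRect ((11 : ℕ) + m) (m + z) + almostRect ((11 : ℕ) - m) (l - m + z) := by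
    decide +kernel
  exact key z (by simp; grind) l (by simp; grind) m (by simp; grind) h2 h

theorem part7_555_not_isTypeP3 : ¬ IsTypeP3 11 part7_555 := by
  rintro ⟨z, m, l, a, h0, h1, h2, h3, h4, h5, h6, rfl, h⟩
  have key : ∀ z ∈ Finset.Icc (0 : ℤ) 10, ∀ l ∈ Finset.Icc (0 : ℤ) (11 - z),
      ∀ m ∈ Finset.Icc (1 : ℤ) l, l < 2 * m →
      (11 : ℕ) + l - m > tabAlpha (11 : ℕ) z l * (l + 2 * z) →
      intParts part7_555 ≠
        almostRect ((11 : ℕ) + (l - m + (2 * m - l) * tabAlpha (11 : ℕ) z l)) (m + z) +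
        almostRect ((11 : ℕ) - (l - m + (2 * m - l) * tabAlpha (11 : ℕ) z l)) (l - m + z) := by
    decide +kernel
  exact key z (by simp; grind) l (by simp; grind) m (by simp; grind) h5 h6 h

theorem part7_555_not_isTypeP4 : ¬ IsTypeP4 11 part7_555 := by
  rintro ⟨z, m, l, a, h0, h1, h2, h3, h4, h5, h6, h7, rfl, h⟩
  have key : ∀ z ∈ Finset.Icc (0 : ℤ) 10, ∀ l ∈ Finset.Icc (0 : ℤ) (11 - z),
      ∀ m ∈ Finset.Icc (1 : ℤ) l, l < 2 * m →
      (11 : ℕ) + m + 2 * z ≤ tabAlpha (11 : ℕ) z l * (l + 2 * z) →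
      tabAlpha (11 : ℕ) z l * (l + 2 * z) < (11 : ℕ) + l + z →
      intParts part7_555 ≠
        almostRect ((11 : ℕ) + (m - (2 * m - l) * tabAlpha (11 : ℕ) z l)) (l - m + z) +
        almostRect ((11 : ℕ) - (m - (2 * m - l) * tabAlpha (11 : ℕ) z l)) (m + z) := by
    decide +kernel
  exact key z (by simp; grind) l (by simp; grind) m (by simp; grind) h5 h6 h7 h

theorem part7_555_not_isTypeP5 : ¬ IsTypeP5 11 part7_555 := by
  rintro ⟨z, m, h0, h1, h2, h3, h⟩
  have key : ∀ z ∈ Finset.Icc (0 : ℤ) 10, ∀ m ∈ Finset.Icc (2 : ℤ) (11 - z),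
      intParts part7_555 ≠ almostRect (11 : ℕ) (z + 1) + almostRect (11 : ℕ) (m + z) := by
    decide +kernel
  exact key z (by simp; grind) m (by simp; grind) h

theorem part7_555_not_isTypeP6 : ¬ IsTypeP6 11 part7_555 := by
  rintro ⟨z, m, l, a, b, rfl, rfl, h0, h1, h2, h⟩
  -- The parts do not involve `m`, and both alternatives imply `0 ≤ β < l`, which already suffices.
  have key : ∀ z ∈ Finset.Icc (0 : ℤ) 10, ∀ l ∈ Finset.Icc (0 : ℤ) (11 - z),
      0 ≤ tabBeta (11 : ℕ) z l → tabBeta (11 : ℕ) z l < l →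
      intParts part7_555 ≠
        copies (2 * tabAlpha (11 : ℕ) z l) (l - tabBeta (11 : ℕ) z l) +
        copies (2 * tabAlpha (11 : ℕ) z l - 1) (2 * z) +
        copies (2 * tabAlpha (11 : ℕ) z l - 2) (tabBeta (11 : ℕ) z l) := by
    decide +kernel
  exact key z (by simp; grind) l (by simp; grind) (by grind) (by grind) h

theorem part7_555_not_isTypeP7 : ¬ IsTypeP7 11 part7_555 := by
  rintro ⟨z, m, l, a, b, rfl, rfl, h0, h1, h2, h3, h4, h5, h6, h7, h⟩
  have key : ∀ z ∈ Finset.Icc (0 : ℤ) 10, ∀ l ∈ Finset.Icc (0 : ℤ) (11 - z),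
      ∀ m ∈ Finset.Icc (1 : ℤ) l, l < 2 * m →
      max (m + z) l ≤ tabBeta (11 : ℕ) z l →
      tabBeta (11 : ℕ) z l < min (2 * l - m + z) (l + 2 * z) →
      intParts part7_555 ≠
        copies (2 * tabAlpha (11 : ℕ) z l - 1) (2 * l - m + z - tabBeta (11 : ℕ) z l) +
        copies (2 * tabAlpha (11 : ℕ) z l - 2) (2 * m - l + 2 * z) +
        copies (2 * tabAlpha (11 : ℕ) z l - 3) (tabBeta (11 : ℕ) z l - m - z) := by
    decide +kernel
  exact key z (by simp; grind) l (by simp; grind) m (by simp; grind) h5 h6 h7 h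

theorem part7_555_not_isTypeP9 : ¬ IsTypeP9 11 part7_555 := by
  rintro ⟨z, m, t, c, h0, h1, h2, h3, h4, h5, h6, h7, h8, rfl, h⟩
  -- The two bounds on `⌈(n+m)/(m+z)⌉(m+z)` together give `t ≤ m`.
  have key : ∀ z ∈ Finset.Icc (0 : ℤ) 10, ∀ m ∈ Finset.Icc (1 : ℤ) 5,
      ∀ t ∈ Finset.Icc (1 : ℤ) m, 2 * m < (11 : ℕ) - z →
      ceilQuot ((11 : ℕ) - m) (m + z) ≤ ceilQuot ((11 : ℕ) - z) (m + z) →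
      ceilQuot ((11 : ℕ) + m) (m + z) ≥ 4 →
      (11 : ℕ) + z + t ≤ ceilQuot ((11 : ℕ) + m) (m + z) * (m + z) →
      ceilQuot ((11 : ℕ) + m) (m + z) * (m + z) ≤ (11 : ℕ) + 2 * m + z - t →
      intParts part7_555 ≠
        almostRect ((11 : ℕ) + (m + ceilQuot ((11 : ℕ) - m - 2 * z) (m + z) * t)) (m + z + t) +
        almostRect ((11 : ℕ) - (m + ceilQuot ((11 : ℕ) - m - 2 * z) (m + z) * t))
          (m + z - t) := by
    decide +kernel
  exact key z (by simp; grind) m (by simp; grind) t (by simp; grind) h3 h4 h5 h7 h8 h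

/-! ### Valuations of trace and determinant. -/

open Polynomial in
theorem exists_quartic_solution_or_dvd {F : Type*} [Field F] {τ δ : F[X]} (hτ : X ∣ τ)
    (hδ : X ∣ δ) (h5 : X ^ 9 ∣ τ ^ 4 - 3 * τ ^ 2 * δ + δ ^ 2)
    (h4 : X ^ 9 ∣ δ * (τ ^ 3 - 2 * τ * δ)) :
    (∃ p₀ q₀ : F, p₀ ≠ 0 ∧ q₀ ≠ 0 ∧ p₀ ^ 2 + 3 * p₀ * q₀ ^ 2 + q₀ ^ 4 = 0) ∨
      (X ^ 11 ∣ τ ^ 5 - 4 * τ ^ 3 * δ + 3 * τ * δ ^ 2 ∧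
        X ^ 11 ∣ δ * (τ ^ 4 - 3 * τ ^ 2 * δ + δ ^ 2)) := by
  have hX : (X : F[X]) ≠ 0 := X_ne_zero
  have hp : Prime (X : F[X]) := prime_X
  obtain ⟨t, rfl⟩ := hτ
  obtain ⟨d, rfl⟩ := hδ
  -- Modulo `X^3` only `X^2 d^2` survives in the quartic form.
  have hd : X ∣ d := by
    have h : X ^ 3 ∣ X ^ 2 * d ^ 2 := by
      have := (dvd_trans (pow_dvd_pow X (by norm_num : 3 ≤ 9)) h5).sub
        (Dvd.intro (X * t ^ 4 - 3 * t ^ 2 * d) rfl : X ^ 3 ∣ X ^ 3 * (X * t ^ 4 - 3 * t ^ 2 * d))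
      convert this using 1
      ring
    rw [pow_succ, mul_dvd_mul_iff_left (pow_ne_zero _ hX)] at h
    exact hp.dvd_of_dvd_pow h
  obtain ⟨d, rfl⟩ := hd
  have h5' : X ^ 5 ∣ t ^ 4 - 3 * t ^ 2 * d + d ^ 2 := by
    rw [← mul_dvd_mul_iff_left (pow_ne_zero 4 hX)]
    convert h5 using 1 <;> ring
  have h4' : X ^ 4 ∣ d * (t ^ 3 - 2 * t * d) := by
    rw [← mul_dvd_mul_iff_left (pow_ne_zero 5 hX)]
    convert h4 using 1 <;> ring
  have e5 := X_dvd_iff.1 (dvd_trans (dvd_pow_self X (by norm_num)) h5')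
  have e4 := X_dvd_iff.1 (dvd_trans (dvd_pow_self X (by norm_num)) h4')
  simp only [coeff_zero_eq_eval_zero, eval_add, eval_sub, eval_mul, eval_pow, eval_ofNat] at e5 e4
  -- If `d(0) ≠ 0`, the second equation gives `t(0)^2 = 2d(0)`, and the first becomes `-d(0)^2 = 0`,
  -- in any characteristic.
  have hd0 : d.eval 0 = 0 := by
    by_contra hne
    have e4' := (mul_eq_zero.1 e4).resolve_left hne
    have ht0 : t.eval 0 ≠ 0 := by
      intro h
      rw [h] at e5
      simp_all
    have : t.eval 0 ^ 2 = 2 * d.eval 0 := mul_left_cancel₀ ht0 (by linear_combination e4')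
    have : d.eval 0 ^ 2 = 0 := by
      linear_combination -e5 + (t.eval 0 ^ 2 - d.eval 0) * this
    exact hne (pow_eq_zero_iff (by norm_num) |>.1 this)
  have ht0 : t.eval 0 = 0 := by
    rw [hd0] at e5
    simpa using e5
  obtain ⟨t, rfl⟩ := X_dvd_iff.2 (by rwa [coeff_zero_eq_eval_zero] : t.coeff 0 = 0)
  obtain ⟨d, rfl⟩ := X_dvd_iff.2 (by rwa [coeff_zero_eq_eval_zero] : d.coeff 0 = 0)
  have hd : X ∣ d := by
    have h : X ^ 3 ∣ X ^ 2 * d ^ 2 := by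
      have := (dvd_trans (pow_dvd_pow X (by norm_num : 3 ≤ 5)) h5').sub
        (Dvd.intro (X * t ^ 4 - 3 * t ^ 2 * d) rfl : X ^ 3 ∣ X ^ 3 * (X * t ^ 4 - 3 * t ^ 2 * d))
      convert this using 1
      ring
    rw [pow_succ, mul_dvd_mul_iff_left (pow_ne_zero _ hX)] at h
    exact hp.dvd_of_dvd_pow h
  obtain ⟨d, rfl⟩ := hd
  -- Now the original trace and determinant are `X^2 t` and `X^4 d`, so the quartic form has a
  -- factor `X^8` and one power of `X` remains.
  have h1 : X ∣ t ^ 4 - 3 * t ^ 2 * d + d ^ 2 := by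
    rw [← mul_dvd_mul_iff_left (pow_ne_zero 4 hX)]
    convert h5' using 1 <;> ring
  have e1 := X_dvd_iff.1 h1
  simp only [coeff_zero_eq_eval_zero, eval_add, eval_sub, eval_mul, eval_pow, eval_ofNat] at e1
  by_cases hd0 : d.eval 0 = 0
  · right
    have ht0 : t.eval 0 = 0 := by
      rw [hd0] at e1
      simpa using e1
    obtain ⟨t, rfl⟩ := X_dvd_iff.2 (by rwa [coeff_zero_eq_eval_zero] : t.coeff 0 = 0)
    obtain ⟨d, rfl⟩ := X_dvd_iff.2 (by rwa [coeff_zero_eq_eval_zero] : d.coeff 0 = 0)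
    constructor
    · exact ⟨X ^ 4 * t ^ 5 - 4 * X ^ 3 * t ^ 3 * d + 3 * X ^ 2 * t * d ^ 2, by ring⟩
    · exact ⟨d * X ^ 4 * (X ^ 2 * t ^ 4 - 3 * X * t ^ 2 * d + d ^ 2), by ring⟩
  · left
    refine ⟨-d.eval 0, t.eval 0, neg_ne_zero.2 hd0, ?_, by linear_combination e1⟩
    intro h
    rw [h] at e1
    simp_all

open Polynomial in
theorem X_pow_five_dvd_of_X_pow_four_dvd {F : Type*} [Field F] {τ δ : F[X]} (hτ : X ∣ τ)
    (hδ : X ∣ δ) (h5 : X ^ 4 ∣ τ ^ 4 - 3 * τ ^ 2 * δ + δ ^ 2) :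
    X ^ 5 ∣ τ ^ 5 - 4 * τ ^ 3 * δ + 3 * τ * δ ^ 2 ∧
      X ^ 5 ∣ δ * (τ ^ 4 - 3 * τ ^ 2 * δ + δ ^ 2) := by
  have hX : (X : F[X]) ≠ 0 := X_ne_zero
  obtain ⟨t, rfl⟩ := hτ
  obtain ⟨d, rfl⟩ := hδ
  have hd : X ∣ d := by
    have h : X ^ 3 ∣ X ^ 2 * d ^ 2 := by
      have := (dvd_trans (pow_dvd_pow X (by norm_num : 3 ≤ 4)) h5).sub
        (Dvd.intro (X * t ^ 4 - 3 * t ^ 2 * d) rfl : X ^ 3 ∣ X ^ 3 * (X * t ^ 4 - 3 * t ^ 2 * d))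
      convert this using 1
      ring
    rw [pow_succ, mul_dvd_mul_iff_left (pow_ne_zero _ hX)] at h
    exact prime_X.dvd_of_dvd_pow h
  obtain ⟨d, rfl⟩ := hd
  constructor
  · exact ⟨t ^ 5 - 4 * t ^ 3 * d + 3 * t * d ^ 2, by ring⟩
  · exact ⟨X * d * (t ^ 4 - 3 * t ^ 2 * d + d ^ 2), by ring⟩

/-! ### Powers of 2×2 matrices. -/

/-- Iterated Cayley-Hamilton: the coefficients are the complete symmetric polynomials of degrees 4
and 3 in the eigenvalues, the second one times the determinant. -/
theorem Matrix.pow_five_fin_two {R : Type*} [CommRing R] (M : Matrix (Fin 2) (Fin 2) R) :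
    M ^ 5 = (M.trace ^ 4 - 3 * M.trace ^ 2 * M.det + M.det ^ 2) • M -
      (M.det * (M.trace ^ 3 - 2 * M.trace * M.det)) • (1 : Matrix (Fin 2) (Fin 2) R) := by
  ext i j
  fin_cases i <;> fin_cases j <;>
    simp [pow_succ, Matrix.mul_apply, Fin.sum_univ_two, Matrix.det_fin_two,
      Matrix.trace_fin_two] <;> ring

theorem Matrix.pow_six_fin_two {R : Type*} [CommRing R] (M : Matrix (Fin 2) (Fin 2) R) :
    M ^ 6 = (M.trace ^ 5 - 4 * M.trace ^ 3 * M.det + 3 * M.trace * M.det ^ 2) • M -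
      (M.det * (M.trace ^ 4 - 3 * M.trace ^ 2 * M.det + M.det ^ 2)) •
        (1 : Matrix (Fin 2) (Fin 2) R) := by
  ext i j
  fin_cases i <;> fin_cases j <;>
    simp [pow_succ, Matrix.mul_apply, Fin.sum_univ_two, Matrix.det_fin_two,
      Matrix.trace_fin_two] <;> ring

/-- A primitive `2 × 2` matrix over a domain that is nilpotent modulo a prime `π`: its trace and
determinant vanish modulo `π`, and divisibility of its fifth power by powers of `π` can be read
off the Cayley-Hamilton coefficients. -/
theorem Matrix.dvd_of_primitive_of_dvd_pow_five {R : Type*} [CommRing R] [IsDomain R] {π : R}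
    (hπ : Prime π) {M : Matrix (Fin 2) (Fin 2) R} (hM : ¬ ∀ i j, π ∣ M i j) {k : ℕ} (hk : k ≠ 0)
    (h : ∀ i j, π ^ k ∣ (M ^ 5) i j) :
    π ∣ M.trace ∧ π ∣ M.det ∧ π ^ k ∣ M.trace ^ 4 - 3 * M.trace ^ 2 * M.det + M.det ^ 2 ∧
      π ^ k ∣ M.det * (M.trace ^ 3 - 2 * M.trace * M.det) := by
  have h1 : ∀ i j, π ∣ (M ^ 5) i j := fun i j => (dvd_pow_self π hk).trans (h i j)
  have hδ : π ∣ M.det := by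
    apply hπ.dvd_of_dvd_pow (n := 5)
    rw [← Matrix.det_pow, Matrix.det_fin_two]
    exact ((h1 0 0).mul_right _).sub ((h1 0 1).mul_right _)
  -- As `π` divides the determinant, `M^5 ≡ τ^4 M` modulo `π`, and some entry of `M` is not
  -- divisible by `π`.
  have hτ : π ∣ M.trace := by
    push Not at hM
    obtain ⟨i, j, hij⟩ := hM
    have h2 := h1 i j
    rw [Matrix.pow_five_fin_two] at h2
    simp only [Matrix.sub_apply, Matrix.smul_apply, smul_eq_mul] at h2
    apply hπ.dvd_of_dvd_pow (n := 4)
    refine (hπ.dvd_or_dvd (a := M.trace ^ 4) (b := M i j) ?_).resolve_right hij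
    obtain ⟨d, hd⟩ := hδ
    obtain ⟨c, hc⟩ := h2
    rw [hd] at hc
    exact ⟨c + (3 * M.trace ^ 2 * d - π * d ^ 2) * M i j +
      d * (M.trace ^ 3 - 2 * M.trace * (π * d)) * (1 : Matrix (Fin 2) (Fin 2) R) i j,
      by linear_combination hc⟩
  -- Otherwise `π` divides the product and the sum of the diagonal entries, hence all entries. Off
  -- the diagonal the identity matrix contributes nothing, which isolates the coefficient of `M`.
  have hoff : ∃ i j, i ≠ j ∧ ¬ π ∣ M i j := by
    by_contra! hcon
    have h01 := hcon 0 1 (by decide)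
    have h10 := hcon 1 0 (by decide)
    have hδ' := hδ
    have hτ' := hτ
    rw [Matrix.det_fin_two] at hδ'
    rw [Matrix.trace_fin_two] at hτ'
    have hp : π ∣ M 0 0 * M 1 1 := by
      simpa using hδ'.add (h01.mul_right (M 1 0))
    refine hM fun i j => ?_
    rcases hπ.dvd_or_dvd hp with h0 | h0
    · have := (dvd_add_right h0).1 hτ'
      fin_cases i <;> fin_cases j <;> assumption
    · have := (dvd_add_left h0).1 hτ'
      fin_cases i <;> fin_cases j <;> assumption
  obtain ⟨i, j, hij, hx⟩ := hoff
  have hc : π ^ k ∣ M.trace ^ 4 - 3 * M.trace ^ 2 * M.det + M.det ^ 2 := by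
    have h2 := h i j
    rw [Matrix.pow_five_fin_two] at h2
    simp only [Matrix.sub_apply, Matrix.smul_apply, smul_eq_mul, Matrix.one_apply_ne hij,
      mul_zero, sub_zero] at h2
    exact hπ.pow_dvd_of_dvd_mul_right k hx h2
  refine ⟨hτ, hδ, hc, ?_⟩
  have h2 := h 0 0
  rw [Matrix.pow_five_fin_two] at h2
  simp only [Matrix.sub_apply, Matrix.smul_apply, smul_eq_mul, Matrix.one_apply_eq,
      mul_one] at h2
  exact (dvd_sub_right (hc.mul_right _)).1 h2

theorem Matrix.exists_eq_smul_of_forall_dvd {m n R : Type*} [CommRing R] {r : R}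
    {M : Matrix m n R} (h : ∀ i j, r ∣ M i j) : ∃ M' : Matrix m n R, M = r • M' := by
  choose M' hM' using h
  exact ⟨Matrix.of M', by ext i j; simpa using hM' i j⟩

open Polynomial in
theorem exists_quartic_solution_of_matrix {F : Type*} [Field F] {M : Matrix (Fin 2) (Fin 2) F[X]}
    (h5 : ∀ i j, X ^ 9 ∣ (M ^ 5) i j) (h6 : ¬ ∀ i j, X ^ 11 ∣ (M ^ 6) i j) :
    ∃ p₀ q₀ : F, p₀ ≠ 0 ∧ q₀ ≠ 0 ∧ p₀ ^ 2 + 3 * p₀ * q₀ ^ 2 + q₀ ^ 4 = 0 := by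
  have hX : (X : F[X]) ≠ 0 := X_ne_zero
  by_cases hM : ∀ i j, X ∣ M i j
  · refine absurd ?_ h6
    obtain ⟨M, rfl⟩ := Matrix.exists_eq_smul_of_forall_dvd hM
    by_cases hM' : ∀ i j, X ∣ M i j
    · obtain ⟨M, rfl⟩ := Matrix.exists_eq_smul_of_forall_dvd hM'
      intro i j
      exact ⟨X * (M ^ 6) i j, by simp [_root_.smul_pow]; ring⟩
    -- After one factor `X` is removed from `M`, the exponent 9 drops to `9 - 5 = 4`, and `11 - 6 =
    -- 5` is needed for the sixth power.
    · have h5' : ∀ i j, X ^ 4 ∣ (M ^ 5) i j := by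
        intro i j
        rw [← mul_dvd_mul_iff_left (pow_ne_zero 5 hX)]
        convert h5 i j using 1
        · ring
        · simp [_root_.smul_pow]
      obtain ⟨hτ, hδ, hc, -⟩ :=
        Matrix.dvd_of_primitive_of_dvd_pow_five prime_X hM' (by norm_num) h5'
      obtain ⟨h1, h2⟩ := X_pow_five_dvd_of_X_pow_four_dvd hτ hδ hc
      intro i j
      have : X ^ 5 ∣ (M ^ 6) i j := by
        rw [Matrix.pow_six_fin_two]
        exact (h1.mul_right _).sub (h2.mul_right _)
      rw [_root_.smul_pow, Matrix.smul_apply, smul_eq_mul, show 11 = 6 + 5 from rfl, pow_add]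
      exact mul_dvd_mul_left _ this
  · obtain ⟨hτ, hδ, hc, hc'⟩ :=
      Matrix.dvd_of_primitive_of_dvd_pow_five prime_X hM (by norm_num) h5
    refine (exists_quartic_solution_or_dvd hτ hδ hc hc').resolve_right fun ⟨h1, h2⟩ => h6 ?_
    intro i j
    rw [Matrix.pow_six_fin_two]
    exact (h1.mul_right _).sub (h2.mul_right _)

/-- Completing the square gives `(2p + 3q^2)^2 = 5q^4`. -/
theorem quartic_rat {p q : ℚ} (h : p ^ 2 + 3 * p * q ^ 2 + q ^ 4 = 0) : p = 0 ∧ q = 0 := by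
  by_cases hq : q = 0
  · subst hq
    simpa using h
  · have h5 : IsSquare ((5 : ℕ) : ℚ) := by
      refine ⟨(2 * p + 3 * q ^ 2) / q ^ 2, ?_⟩
      field_simp
      push_cast
      linear_combination -4 * h
    rw [Rat.isSquare_natCast_iff] at h5
    exact absurd (Nat.prime_five.prime.irreducible) h5.not_irreducible

/-! ### Jordan matrices and the module structure over `F[X]`. -/

theorem jordanBlock_pow_apply {F : Type*} [Field F] (n k : ℕ) (i j : Fin n) :
    (jordanBlock F n ^ k) i j = if (i : ℕ) + k = j then 1 else 0 := by
  induction k generalizing i j with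
  | zero => simp [Matrix.one_apply, Fin.ext_iff]
  | succ k ih =>
    rw [pow_succ', Matrix.mul_apply]
    simp only [ih]
    simp only [jordanBlock, Matrix.of_apply, ite_mul, one_mul, zero_mul]
    by_cases hi : (i : ℕ) + 1 < n
    · rw [Finset.sum_eq_single ⟨i + 1, hi⟩]
      · simp [add_assoc, add_comm 1 k]
      · intro b _ hb
        rw [if_neg]
        intro h
        exact hb (Fin.ext h.symm)
      · simp
    · rw [Finset.sum_eq_zero, if_neg]
      · have := j.2
        omega
      · intro b _
        rw [if_neg]
        have := b.2
        omega

theorem jordanMatrix_pow_apply {F : Type*} [Field F] (L : List ℕ) (k : ℕ)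
    (x y : Σ i : Fin L.length, Fin (L.get i)) :
    (jordanMatrix F L ^ k) x y = if x.1 = y.1 ∧ (x.2 : ℕ) + k = y.2 then 1 else 0 := by
  obtain ⟨i, a⟩ := x
  obtain ⟨j, b⟩ := y
  rw [jordanMatrix, ← Matrix.blockDiagonal'_pow]
  by_cases h : i = j
  · subst h
    rw [Matrix.blockDiagonal'_apply_eq, Pi.pow_apply, jordanBlock_pow_apply]
    simp
  · rw [Matrix.blockDiagonal'_apply_ne _ _ _ h]
    simp [h]

open scoped Matrix in
open Polynomial in
theorem aeval_jordanMatrix_apply {F : Type*} [Field F] (L : List ℕ) (h : F[X])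
    (x y : Σ i : Fin L.length, Fin (L.get i)) :
    (aeval (jordanMatrix F L) h) x y =
      if x.1 = y.1 ∧ (x.2 : ℕ) ≤ y.2 then h.coeff (y.2 - x.2) else 0 := by
  induction h using Polynomial.induction_on' with
  | add p q hp hq =>
    rw [map_add, Matrix.add_apply, hp, hq]
    split_ifs <;> simp
  | monomial k c =>
    rw [aeval_monomial, ← Algebra.smul_def, Matrix.smul_apply,
      jordanMatrix_pow_apply, coeff_monomial, smul_eq_mul]
    split_ifs <;> first | (simp; done) | grind

/-- A member of a nilpotent orbit is similar to the Jordan matrix, through a change of basis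
indexed by the Jordan blocks. -/
theorem exists_eq_mul_jordanMatrix_mul {F : Type*} [Field F] {N : ℕ} {p : Nat.Partition N}
    {A : Matrix (Fin N) (Fin N) F} (hA : A ∈ nilpotentOrbit F p) {L : List ℕ}
    (hL : p.parts.sort (· ≥ ·) = L) :
    ∃ (P : Matrix (Fin N) (Σ i : Fin L.length, Fin (L.get i)) F)
      (Q : Matrix (Σ i : Fin L.length, Fin (L.get i)) (Fin N) F),
      P * Q = 1 ∧ Q * P = 1 ∧ A * P = P * jordanMatrix F L := by
  subst hL
  obtain ⟨e, g, rfl⟩ := hA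
  have h1 : (g : Matrix (Fin N) (Fin N) F) * ((g⁻¹ : GL (Fin N) F) : Matrix (Fin N) (Fin N) F) = 1 :=
    Units.mul_inv g
  have h2 : ((g⁻¹ : GL (Fin N) F) : Matrix (Fin N) (Fin N) F) * (g : Matrix (Fin N) (Fin N) F) = 1 :=
    Units.inv_mul g
  generalize (g : Matrix (Fin N) (Fin N) F) = G at *
  generalize ((g⁻¹ : GL (Fin N) F) : Matrix (Fin N) (Fin N) F) = H at *
  refine ⟨G.submatrix id e, H.submatrix e id, ?_, ?_, ?_⟩
  · rw [Matrix.submatrix_mul_equiv, h1, Matrix.submatrix_id_id]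
  · rw [Matrix.submatrix_mul _ _ e id e Function.bijective_id |>.symm, h2,
      Matrix.submatrix_one_equiv]
  · have : G.submatrix id e = G * (1 : Matrix (Fin N) (Fin N) F).submatrix id e := by
      rw [← Matrix.submatrix_id_id G, ← Matrix.submatrix_mul _ _ id id e Function.bijective_id]
      simp
    set J := jordanMatrix F _
    calc G * Matrix.reindex e e J * H * G.submatrix id e
        = G * Matrix.reindex e e J * (H * G) * (1 : Matrix (Fin N) (Fin N) F).submatrix id e := by
          rw [this]; simp only [Matrix.mul_assoc]
      _ = G.submatrix id e * J := by
          rw [h2, Matrix.mul_one, Matrix.mul_assoc]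
          ext i j
          simp [Matrix.mul_apply, Matrix.one_apply]
          exact (Equiv.sum_comp e.symm (fun x => G i (e x) * J x j)).symm.trans (by simp) |>.symm

theorem Matrix.pow_mul_eq_mul_pow {m n R : Type*} [Fintype m] [Fintype n] [DecidableEq m]
    [DecidableEq n] [CommRing R] {A : Matrix m m R} {P : Matrix m n R} {J : Matrix n n R}
    (h : A * P = P * J) (k : ℕ) : A ^ k * P = P * J ^ k := by
  induction k with
  | zero => simp
  | succ k ih => rw [pow_succ, Matrix.mul_assoc, h, ← Matrix.mul_assoc, ih, Matrix.mul_assoc,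
      ← pow_succ]

open scoped Matrix in
open Polynomial in
theorem Matrix.aeval_mul_eq_mul_aeval {m n R : Type*} [Fintype m] [Fintype n] [DecidableEq m]
    [DecidableEq n] [CommRing R] {A : Matrix m m R} {P : Matrix m n R} {J : Matrix n n R}
    (h : A * P = P * J) (f : R[X]) : aeval A f * P = P * aeval J f := by
  induction f using Polynomial.induction_on' with
  | add p q hp hq => rw [map_add, map_add, Matrix.add_mul, Matrix.mul_add, hp, hq]
  | monomial k c =>
    simp only [aeval_monomial, ← Algebra.smul_def, Matrix.smul_mul, Matrix.mul_smul,
      Matrix.pow_mul_eq_mul_pow h]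

open scoped Matrix in
open Polynomial in
/-- If all Jordan blocks of `B` have size `n + 1`, then `B` turns `F ^ N` into a free module over
`F[X] / (X ^ (n + 1))`. -/
theorem exists_generators_of_mem_nilpotentOrbit {F : Type*} [Field F] {N : ℕ} {p : Nat.Partition N}
    {B : Matrix (Fin N) (Fin N) F} (hB : B ∈ nilpotentOrbit F p) {L : List ℕ}
    (hL : p.parts.sort (· ≥ ·) = L) {n : ℕ} (hn : ∀ i, L.get i = n + 1) :
    ∃ v : Fin L.length → Fin N → F,
      (∀ w, ∃ f : Fin L.length → F[X], w = ∑ i, aeval B (f i) *ᵥ v i) ∧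
      ∀ f : Fin L.length → F[X],
        ∑ i, aeval B (f i) *ᵥ v i = 0 ↔ ∀ i, X ^ (n + 1) ∣ f i := by
  obtain ⟨P, Q, hPQ, hQP, hBP⟩ := exists_eq_mul_jordanMatrix_mul hB hL
  -- With ones on the superdiagonal a block shifts basis vectors downwards in index, so the last one
  -- is cyclic: `X^k` sends it to index `n - k`.
  let last (i : Fin L.length) : Σ i : Fin L.length, Fin (L.get i) := ⟨i, n, by rw [hn]; omega⟩
  let v (i : Fin L.length) : Fin N → F := P *ᵥ Pi.single (last i) 1
  have key : ∀ f : Fin L.length → F[X],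
      ∑ i, aeval B (f i) *ᵥ v i = P *ᵥ fun x => (f x.1).coeff (n - x.2) := by
    intro f
    simp only [v, Matrix.mulVec_mulVec, Matrix.aeval_mul_eq_mul_aeval hBP]
    simp only [← Matrix.mulVec_mulVec]
    rw [← Matrix.mulVec_sum]
    congr 1
    ext x
    have hx := x.2.2
    have hx' := hn x.1
    have hle : (x.2 : ℕ) ≤ n := by omega
    rw [Finset.sum_apply, Finset.sum_eq_single x.1]
    · simp [aeval_jordanMatrix_apply, last, hle]
    · intro i _ hi
      simp [aeval_jordanMatrix_apply, last, hi.symm]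
    · simp
  refine ⟨v, fun w => ?_, fun f => ?_⟩
  · let g (i : Fin L.length) : F[X] := ∑ k : Fin (L.get i), monomial (n - k) ((Q *ᵥ w) ⟨i, k⟩)
    refine ⟨g, ?_⟩
    rw [key]
    have : (fun x : Σ i : Fin L.length, Fin (L.get i) => (g x.1).coeff (n - x.2)) = Q *ᵥ w := by
      ext ⟨i, a⟩
      simp only [g, finsetSum_coeff, coeff_monomial]
      rw [Finset.sum_eq_single a]
      · simp
      · intro b _ hb
        rw [if_neg]
        have := hn i
        have := a.2
        have := b.2
        have : (b : ℕ) ≠ a := fun h => hb (Fin.ext h)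
        omega
      · simp
    rw [this, Matrix.mulVec_mulVec, hPQ, Matrix.one_mulVec]
  · rw [key]
    constructor
    · intro h i
      have h' := congrArg (Q *ᵥ ·) h
      simp only [Matrix.mulVec_mulVec, hQP, Matrix.one_mulVec, Matrix.mulVec_zero] at h'
      rw [X_pow_dvd_iff]
      intro d hd
      have := congrFun h' ⟨i, n - d, by rw [hn]; omega⟩
      simpa [Nat.sub_sub_self (Nat.lt_succ_iff.1 hd)] using this
    · intro h
      have : (fun x : Σ i : Fin L.length, Fin (L.get i) => (f x.1).coeff (n - x.2)) = 0 := by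
        ext x
        exact X_pow_dvd_iff.1 (h x.1) _ (by omega)
      rw [this, Matrix.mulVec_zero]

open scoped Matrix in
open Polynomial in
-- Any choice of coefficients of `A v_j` serves as column `j`; powers are respected because `A`
-- commutes with polynomials in `B`.
theorem exists_polynomial_matrix_of_commute {F ι : Type*} [Field F] [Fintype ι] [DecidableEq ι]
    {r : ℕ} {A B : Matrix ι ι F} (hAB : Commute A B) {v : Fin r → ι → F}
    (hv : ∀ w, ∃ f : Fin r → F[X], w = ∑ i, aeval B (f i) *ᵥ v i) :
    ∃ M : Matrix (Fin r) (Fin r) F[X],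
      ∀ k j, A ^ k *ᵥ v j = ∑ i, aeval B ((M ^ k) i j) *ᵥ v i := by
  choose f hf using hv
  refine ⟨Matrix.of fun i j => f (A *ᵥ v j) i, fun k j => ?_⟩
  set M : Matrix (Fin r) (Fin r) F[X] := Matrix.of fun i j => f (A *ᵥ v j) i
  have hM : ∀ j, A *ᵥ v j = ∑ i, aeval B (M i j) *ᵥ v i := fun j => hf (A *ᵥ v j)
  have hcomm : ∀ g : F[X], A * aeval B g = aeval B g * A := fun g =>
    Matrix.aeval_mul_eq_mul_aeval hAB.symm.eq g |>.symm
  induction k with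
  | zero =>
    rw [Finset.sum_eq_single j]
    · simp
    · intro b _ hb
      simp [hb]
    · simp
  | succ k ih =>
    rw [pow_succ', ← Matrix.mulVec_mulVec, ih, Matrix.mulVec_sum]
    simp only [Matrix.mulVec_mulVec, hcomm]
    simp only [← Matrix.mulVec_mulVec, hM, Matrix.mulVec_sum]
    rw [Finset.sum_comm]
    refine Finset.sum_congr rfl fun i _ => ?_
    rw [pow_succ', Matrix.mul_apply, map_sum, Matrix.sum_mulVec]
    refine Finset.sum_congr rfl fun l _ => ?_
    rw [Matrix.mulVec_mulVec, ← map_mul, mul_comm]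

/-! ### Rank bounds and the intersection point. -/

/-- `S` restricts to a nilpotent endomorphism of the range of `T`, whose characteristic polynomial
is a power of `X`; Cayley-Hamilton applies. -/
theorem pow_finrank_range_mul_eq_zero {F V : Type*} [Field F] [AddCommGroup V] [Module F V]
    [FiniteDimensional F V] {S T : Module.End F V} (h : Commute S T) (hS : IsNilpotent S) :
    S ^ Module.finrank F (LinearMap.range T) * T = 0 := by
  have hmaps : ∀ x ∈ LinearMap.range T, S x ∈ LinearMap.range T := by
    rintro _ ⟨y, rfl⟩
    exact ⟨S y, (LinearMap.congr_fun h.eq y).symm⟩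
  have hnil : IsNilpotent (S.restrict hmaps) := Module.End.isNilpotent.restrict hmaps hS
  have h0 := LinearMap.aeval_self_charpoly (S.restrict hmaps)
  rw [IsNilpotent.charpoly_eq_X_pow_finrank hnil, map_pow, Polynomial.aeval_X,
    Module.End.pow_restrict] at h0
  ext x
  simpa using congrArg Subtype.val (LinearMap.congr_fun h0 ⟨T x, x, rfl⟩)

theorem Matrix.pow_mul_eq_zero_of_rank_le {F ι : Type*} [Field F] [Fintype ι] [DecidableEq ι]
    {S T : Matrix ι ι F} (h : Commute S T) (hS : IsNilpotent S) {k : ℕ} (hT : T.rank ≤ k) :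
    S ^ k * T = 0 := by
  have h0 := pow_finrank_range_mul_eq_zero (h.map (Matrix.toLinAlgEquiv' (R := F) (n := ι)))
    (hS.map (Matrix.toLinAlgEquiv' (R := F) (n := ι)))
  rw [← map_pow, ← map_mul, map_eq_zero_iff _ (AlgEquiv.injective _)] at h0
  have : Module.finrank F (LinearMap.range (Matrix.toLinAlgEquiv' T)) = T.rank := rfl
  rw [this] at h0
  rw [← Nat.sub_add_cancel hT, pow_add, Matrix.mul_assoc, h0, Matrix.mul_zero]

theorem Multiset.sort_eq_of_pairwise {s : Multiset ℕ} {L : List ℕ} (h : s = L)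
    (hL : L.Pairwise (· ≥ ·)) : s.sort (· ≥ ·) = L := by
  refine List.Perm.eq_of_pairwise (le := (· ≥ ·)) ?_ (Multiset.pairwise_sort _ _) hL ?_
  · intro a b _ _ h1 h2
    exact le_antisymm h2 h1
  · rw [← Multiset.coe_eq_coe, Multiset.sort_eq, h]

theorem isNilpotent_of_mem_nilpotentOrbit {F : Type*} [Field F] {N : ℕ} {p : Nat.Partition N}
    {B : Matrix (Fin N) (Fin N) F} (hB : B ∈ nilpotentOrbit F p) : IsNilpotent B := by
  obtain ⟨P, Q, hPQ, -, hBP⟩ := exists_eq_mul_jordanMatrix_mul hB rfl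
  refine ⟨N, ?_⟩
  have : jordanMatrix F (p.parts.sort (· ≥ ·)) ^ N = 0 := by
    ext x y
    rw [jordanMatrix_pow_apply, if_neg, Matrix.zero_apply]
    rintro ⟨-, h⟩
    have h1 := y.2.2
    have h2 : (p.parts.sort (· ≥ ·)).get y.1 ≤ N := by
      refine p.le_of_mem_parts ?_
      rw [← Multiset.mem_sort (· ≥ ·)]
      exact List.get_mem _ _
    omega
  rw [← Matrix.mul_one (B ^ N), ← hPQ, ← Matrix.mul_assoc, Matrix.pow_mul_eq_mul_pow hBP, this,
    Matrix.mul_zero, Matrix.zero_mul]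

theorem rank_jordanMatrix_pow_five_le {F : Type*} [Field F] :
    (jordanMatrix F [7, 5, 5, 5] ^ 5).rank ≤ 2 := by
  -- The fifth power has just two ones, at (0,5) and (1,6) of the block of size 7, so it factors
  -- through `F^2`.
  let C : Matrix (Σ i : Fin [7, 5, 5, 5].length, Fin ([7, 5, 5, 5].get i)) (Fin 2) F :=
    Matrix.of fun x k => if x.1 = 0 ∧ (x.2 : ℕ) = k then 1 else 0
  let D : Matrix (Fin 2) (Σ i : Fin [7, 5, 5, 5].length, Fin ([7, 5, 5, 5].get i)) F :=
    Matrix.of fun k x => if x.1 = 0 ∧ (x.2 : ℕ) = k + 5 then 1 else 0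
  have : jordanMatrix F [7, 5, 5, 5] ^ 5 = C * D := by
    ext ⟨i, a, ha⟩ ⟨j, b, hb⟩
    rw [jordanMatrix_pow_apply, Matrix.mul_apply, Fin.sum_univ_two]
    simp only [C, D, Matrix.of_apply]
    by_cases hj : j = 0
    · subst hj
      replace hb : b < 7 := hb
      by_cases hi : i = 0
      · subst hi
        simp
        split_ifs <;> first | (exfalso; omega) | simp
      · simp [hi]
    · replace hb : b < 5 := by
        fin_cases j
        · exact absurd rfl hj
        all_goals exact hb
      rw [if_neg (by omega)]
      simp [hj]
  rw [this]
  exact (Matrix.rank_mul_le_left C D).trans (by simpa using Matrix.rank_le_card_width C)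

theorem jordanMatrix_pow_six_ne_zero {F : Type*} [Field F] :
    jordanMatrix F [7, 5, 5, 5] ^ 6 ≠ 0 := by
  intro h
  have := congrFun (congrFun h ⟨0, (0 : Fin 7)⟩) ⟨0, (6 : Fin 7)⟩
  rw [jordanMatrix_pow_apply, if_pos ⟨rfl, rfl⟩] at this
  exact one_ne_zero this

open scoped Matrix in
open Polynomial in
theorem exists_quartic_solution_of_mem_inter {F : Type*} [Field F]
    {A B : Matrix (Fin (2 * 11)) (Fin (2 * 11)) F} (hB : B ∈ nilpotentOrbit F part11_11)
    (hA : A ∈ nilpotentOrbit F part7_555) (hAB : Commute A B) :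
    ∃ p₀ q₀ : F, p₀ ≠ 0 ∧ q₀ ≠ 0 ∧ p₀ ^ 2 + 3 * p₀ * q₀ ^ 2 + q₀ ^ 4 = 0 := by
  obtain ⟨P, Q, hPQ, hQP, hAP⟩ :=
    exists_eq_mul_jordanMatrix_mul hA (L := [7, 5, 5, 5])
      (Multiset.sort_eq_of_pairwise rfl (by decide))
  obtain ⟨v, hspan, hzero⟩ := exists_generators_of_mem_nilpotentOrbit hB (L := [11, 11])
    (Multiset.sort_eq_of_pairwise rfl (by decide)) (n := 10) (by decide)
  obtain ⟨M, hM⟩ := exists_polynomial_matrix_of_commute hAB hspan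
  have hrank : (A ^ 5).rank ≤ 2 := by
    have : A ^ 5 = P * jordanMatrix F [7, 5, 5, 5] ^ 5 * Q := by
      rw [← Matrix.pow_mul_eq_mul_pow hAP, Matrix.mul_assoc, hPQ, Matrix.mul_one]
    rw [this]
    exact (Matrix.rank_mul_le_left _ _).trans
      ((Matrix.rank_mul_le_right _ _).trans rank_jordanMatrix_pow_five_le)
  have hBA : B ^ 2 * A ^ 5 = 0 := Matrix.pow_mul_eq_zero_of_rank_le (hAB.symm.pow_right 5)
    (isNilpotent_of_mem_nilpotentOrbit hB) hrank
  refine exists_quartic_solution_of_matrix (M := M) (fun i j => ?_) fun h6 => ?_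
  · have : ∑ i, aeval B (X ^ 2 * (M ^ 5) i j) *ᵥ v i = 0 := by
      simp only [map_mul, map_pow, aeval_X, ← Matrix.mulVec_mulVec]
      rw [← Matrix.mulVec_sum, ← hM, Matrix.mulVec_mulVec, hBA, Matrix.zero_mulVec]
    have := (hzero _).1 this i
    rw [show 10 + 1 = 2 + 9 from rfl, pow_add,
      mul_dvd_mul_iff_left (pow_ne_zero 2 X_ne_zero)] at this
    exact this
  · have hv : ∀ j, A ^ 6 *ᵥ v j = 0 := fun j => by
      rw [hM, hzero]
      exact fun i => h6 i j
    -- `A^6` kills the generators and commutes with polynomials in `B`, so it kills everything.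
    have hA6 : A ^ 6 = 0 := by
      refine Matrix.ext_of_mulVec_single fun i => ?_
      obtain ⟨f, hf⟩ := hspan (Pi.single i 1)
      rw [hf, Matrix.mulVec_sum, Matrix.zero_mulVec]
      refine Finset.sum_eq_zero fun l _ => ?_
      rw [Matrix.mulVec_mulVec, ← Matrix.aeval_mul_eq_mul_aeval
        (hAB.symm.pow_right 6).eq, ← Matrix.mulVec_mulVec, hv, Matrix.mulVec_zero]
    apply jordanMatrix_pow_six_ne_zero (F := F)
    rw [← Matrix.one_mul (jordanMatrix F _ ^ 6), ← hQP, Matrix.mul_assoc,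
      ← Matrix.pow_mul_eq_mul_pow hAP, hA6, Matrix.zero_mul, Matrix.mul_zero]

theorem mainTheorem2 :
    -- the partition `(7, 5³)` is of type (P8), with `z = 0`, `m = 2`, `t = 1`, and of no other type
    (IsTypeP8With 11 part7_555 0 2 1 ∧ IsTypeP8 11 part7_555 ∧
      ¬ IsTypeP1 11 part7_555 ∧ ¬ IsTypeP2 11 part7_555 ∧ ¬ IsTypeP3 11 part7_555 ∧
      ¬ IsTypeP4 11 part7_555 ∧ ¬ IsTypeP5 11 part7_555 ∧ ¬ IsTypeP6 11 part7_555 ∧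
      ¬ IsTypeP7 11 part7_555 ∧ ¬ IsTypeP9 11 part7_555) ∧
    -- over any field, an intersection point forces a solution of the quartic equation
    (∀ (F : Type*) [Field F] (B : Matrix (Fin (2 * 11)) (Fin (2 * 11)) F),
      B ∈ nilpotentOrbit F part11_11 →
      (nilpotentOrbit F part7_555 ∩ nilpotentCentralizer B).Nonempty →
      ∃ p₀ q₀ : F, p₀ ≠ 0 ∧ q₀ ≠ 0 ∧ p₀ ^ 2 + 3 * p₀ * q₀ ^ 2 + q₀ ^ 4 = 0) ∧
    -- there is no non-zero rational solution
    (∀ p₀ q₀ : ℚ, p₀ ^ 2 + 3 * p₀ * q₀ ^ 2 + q₀ ^ 4 = 0 → p₀ = 0 ∧ q₀ = 0) ∧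
    -- over `ℚ` the orbit does not meet the nilpotent centralizer
    (∀ B : Matrix (Fin (2 * 11)) (Fin (2 * 11)) ℚ,
      B ∈ nilpotentOrbit ℚ part11_11 →
      nilpotentOrbit ℚ part7_555 ∩ nilpotentCentralizer B = ∅) := by
  refine ⟨⟨part7_555_isTypeP8With, ⟨0, 2, 1, part7_555_isTypeP8With⟩, part7_555_not_isTypeP1,
    part7_555_not_isTypeP2, part7_555_not_isTypeP3, part7_555_not_isTypeP4,
    part7_555_not_isTypeP5, part7_555_not_isTypeP6, part7_555_not_isTypeP7,
    part7_555_not_isTypeP9⟩, ?_, fun _ _ => quartic_rat, ?_⟩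
  · rintro F _ B hB ⟨A, hA, hAB, -⟩
    exact exists_quartic_solution_of_mem_inter hB hA hAB
  · intro B hB
    refine Set.eq_empty_of_forall_notMem ?_
    rintro A ⟨hA, hAB, -⟩
    obtain ⟨p, q, hp, -, h⟩ := exists_quartic_solution_of_mem_inter hB hA hAB
    exact hp (quartic_rat h).1
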